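/- The \emph{burning game} on a finite simple graph $G$ is played by Burner and Staller, who select vertices alternately. Initially all vertices are unburned, and burned vertices stay burned. In each round $t = 1, 2, \dots$, first every neighbour of a burned vertex becomes burned (spreading phase), and then, if an unburned vertex remains, the player whose turn it is selects one unburned vertex, which becomes burned (selection phase). The game ends in the first round in which all vertices are burned (possibly after the spreading phase alone). Burner wants to minimize the number of rounds and Staller wants to maximize it. The \emph{game burning number} $b_{\rm g}(G)$ is the number of rounds when Burner makes the first selection and both players play optimally. \textbf{Proposition.} Let $G$ be a finite simple graph (not necessarily connected) of order $n \geq 2$, and let $\overline{G}$ be its complement. Then $$4 \leq b_{\rm g}(G)\, b_{\rm g}(\overline{G}) \leq 2n.$$ -/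

import Mathlib

/-- The two players of the burning game. -/
inductive BurningPlayer : Type
  | burner
  | staller

/-- The spreading phase: the set of burned vertices after all neighbours of the vertices
burned so far (the set `B`) have caught fire. -/
def burningSpread {V : Type*} [Fintype V] [DecidableEq V] (G : SimpleGraph V)
    [DecidableRel G.Adj] (B : Finset V) : Finset V :=
  Finset.univ.filter fun v => v ∈ B ∨ ∃ u ∈ B, G.Adj u v

theorem subset_burningSpread {V : Type*} [Fintype V] [DecidableEq V] (G : SimpleGraph V)
    [DecidableRel G.Adj] (B : Finset V) : B ⊆ burningSpread G B := by
  intro v hv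
  simp [burningSpread, hv]

/-- A selection strictly decreases the number of unburned vertices. -/
theorem card_compl_insert_burningSpread_lt {V : Type*} [Fintype V] [DecidableEq V]
    (G : SimpleGraph V) [DecidableRel G.Adj] (B : Finset V) (v : V)
    (hv : v ∈ (burningSpread G B)ᶜ) :
    (insert v (burningSpread G B))ᶜ.card < Bᶜ.card := by
  apply Finset.card_lt_card
  rw [Finset.mem_compl] at hv
  rw [Finset.compl_ssubset_compl]
  exact lt_of_le_of_lt (subset_burningSpread G B) (Finset.ssubset_insert hv)

/-- The number of further rounds of the burning game on `G` under optimal play, when the vertices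
of `B` are burned at the end of the previous round and `p` makes the selection in the next round.

If every vertex is burned, the game is over. Otherwise one more round is played: first the fire
spreads, and if this burns every vertex, the game ends with this round; if not, then `p` selects
an unburned vertex, and the other player makes the selection in the round after. Burner minimizes
and Staller maximizes the number of rounds. -/
def burningGameLength {V : Type*} [Fintype V] [DecidableEq V] (G : SimpleGraph V)
    [DecidableRel G.Adj] (p : BurningPlayer) (B : Finset V) : ℕ :=
  if B = Finset.univ then 0
  else if h : burningSpread G B = Finset.univ then 1
  else
    have hne : (burningSpread G B)ᶜ.attach.Nonempty :=
      Finset.attach_nonempty_iff.mpr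
        (Finset.nonempty_iff_ne_empty.mpr fun h0 => h ((Finset.compl_eq_empty_iff _).mp h0))
    match p with
    | .burner => 1 + (burningSpread G B)ᶜ.attach.inf' hne fun v =>
        burningGameLength G .staller (insert v.1 (burningSpread G B))
    | .staller => 1 + (burningSpread G B)ᶜ.attach.sup' hne fun v =>
        burningGameLength G .burner (insert v.1 (burningSpread G B))
termination_by Bᶜ.card
decreasing_by
  all_goals exact card_compl_insert_burningSpread_lt G B v.1 v.2

/-- The game burning number: the number of rounds of the burning game under optimal play, when no
vertex is burned initially and Burner makes the first selection. -/
def gameBurningNumber {V : Type*} [Fintype V] [DecidableEq V] (G : SimpleGraph V)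
    [DecidableRel G.Adj] : ℕ :=
  burningGameLength G .burner ∅

section BurningGame

variable {V : Type*} [Fintype V] [DecidableEq V] (G : SimpleGraph V) [DecidableRel G.Adj]

/-! Lower bound: both factors are at least 2. Upper bound, with n the order: every round burns a new
vertex, so each factor is at most n. If G or its complement has a vertex of degree at most 1, that
vertex is a winning start in the other graph, whose factor is then at most 2
(`gameBurningNumber_le_two`). Otherwise both minimum degrees are at least 2, so both factors are at
most (n + 1)/2 (`two_mul_gameBurningNumber_le`). One of them is also at most 3
(`gameBurningNumber_le_three_or_compl`), and 3(n + 1)/2 ≤ 2n once n ≥ 3. -/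

theorem mem_burningSpread {B : Finset V} {v : V} :
    v ∈ burningSpread G B ↔ v ∈ B ∨ ∃ u ∈ B, G.Adj u v := by
  simp [burningSpread]

theorem burningGameLength_univ (p : BurningPlayer) :
    burningGameLength G p Finset.univ = 0 := by
  rw [burningGameLength]; simp

theorem burningGameLength_le_one_of_spread_eq_univ (p : BurningPlayer) {B : Finset V}
    (h : burningSpread G B = Finset.univ) : burningGameLength G p B ≤ 1 := by
  rw [burningGameLength]
  split_ifs <;> simp

theorem one_le_burningGameLength (p : BurningPlayer) {B : Finset V} (h : B ≠ Finset.univ) :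
    1 ≤ burningGameLength G p B := by
  rw [burningGameLength, if_neg h]
  split_ifs
  · exact le_rfl
  · cases p <;> exact Nat.le_add_right _ _

/-- A bound that holds whatever the selection is, for either player. -/
theorem burningGameLength_le_succ (p : BurningPlayer) {B : Finset V} {k : ℕ}
    (H : ∀ q, ∀ v ∉ burningSpread G B,
      burningGameLength G q (insert v (burningSpread G B)) ≤ k) :
    burningGameLength G p B ≤ k + 1 := by
  rw [burningGameLength]
  split_ifs with h1 h2
  · simp
  · simp
  · have hne : (burningSpread G B)ᶜ.attach.Nonempty :=
      Finset.attach_nonempty_iff.mpr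
        (Finset.nonempty_iff_ne_empty.mpr fun h0 => h2 ((Finset.compl_eq_empty_iff _).mp h0))
    cases p
    · obtain ⟨v, hv⟩ := hne
      have h3 := Finset.inf'_le (fun v : { x // x ∈ (burningSpread G B)ᶜ } =>
        burningGameLength G .staller (insert v.1 (burningSpread G B))) hv
      have h4 := H .staller v.1 (Finset.mem_compl.mp v.2)
      dsimp only at h3 ⊢
      omega
    · dsimp only
      rw [add_comm]
      refine Nat.add_le_add_right (Finset.sup'_le _ _ fun v _ => ?_) 1
      exact H .burner v.1 (Finset.mem_compl.mp v.2)

/-- Burner may start with any vertex. -/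
theorem gameBurningNumber_le_succ (v : V) {k : ℕ}
    (H : burningGameLength G .staller {v} ≤ k) : gameBurningNumber G ≤ k + 1 := by
  have hs : burningSpread G ∅ = ∅ := by ext; simp [burningSpread]
  rw [gameBurningNumber, burningGameLength]
  split_ifs with h1 h2
  · simp
  · simp
  · have hv : (⟨v, by simp [hs]⟩ : { x // x ∈ (burningSpread G ∅)ᶜ }) ∈
        (burningSpread G ∅)ᶜ.attach := Finset.mem_attach _ _
    have h3 := Finset.inf'_le (fun v : { x // x ∈ (burningSpread G ∅)ᶜ } =>
        burningGameLength G .staller (insert v.1 (burningSpread G ∅))) hv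
    have h4 : insert v (burningSpread G ∅) = {v} := by rw [hs]; rfl
    dsimp only at h3 ⊢
    rw [h4] at h3
    omega

/-- Nothing spreads from the empty set, so round one burns a single vertex. -/
theorem two_le_gameBurningNumber (hn : 2 ≤ Fintype.card V) : 2 ≤ gameBurningNumber G := by
  have hs : burningSpread G ∅ = ∅ := by ext; simp [burningSpread]
  have he : (∅ : Finset V) ≠ Finset.univ := by
    intro h
    have := congrArg Finset.card h
    rw [Finset.card_univ, Finset.card_empty] at this
    omega
  rw [gameBurningNumber, burningGameLength, if_neg he, dif_neg (by rwa [hs])]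
  dsimp only
  refine Nat.add_le_add_left (n := 1) (Finset.le_inf' _ _ fun v _ => ?_) 1
  refine one_le_burningGameLength G _ fun h => ?_
  have := congrArg Finset.card h
  rw [Finset.card_insert_of_notMem (Finset.mem_compl.mp v.2), hs, Finset.card_univ,
    Finset.card_empty] at this
  omega

theorem burningGameLength_le_card_compl (p : BurningPlayer) (B : Finset V) :
    burningGameLength G p B ≤ Bᶜ.card := by
  induction hk : Bᶜ.card using Nat.strong_induction_on generalizing p B with
  | _ k ih =>
    subst hk
    by_cases hB : B = Finset.univ
    · rw [hB, burningGameLength_univ]; simp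
    · have hpos : 0 < Bᶜ.card :=
        Finset.card_pos.mpr (Finset.nonempty_iff_ne_empty.mpr fun h0 =>
          hB ((Finset.compl_eq_empty_iff _).mp h0))
      have := burningGameLength_le_succ G p (B := B) (k := Bᶜ.card - 1) fun q v hv => by
        have h1 := card_compl_insert_burningSpread_lt G B v (Finset.mem_compl.mpr hv)
        have h2 := ih _ h1 q _ rfl
        omega
      omega

theorem gameBurningNumber_le_card : gameBurningNumber G ≤ Fintype.card V := by
  simpa [gameBurningNumber] using burningGameLength_le_card_compl G .burner ∅

/-- A selection burns one vertex on top of those burned by spreading. -/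
theorem card_compl_insert_burningSpread {B : Finset V} {v : V} (hv : v ∉ burningSpread G B) :
    (insert v (burningSpread G B))ᶜ.card + 1 + (burningSpread G B \ B).card = Bᶜ.card := by
  have h1 := Finset.card_sdiff_add_card_eq_card (subset_burningSpread G B)
  have h2 := Finset.card_compl_add_card B
  have h3 := Finset.card_compl_add_card (insert v (burningSpread G B))
  rw [Finset.card_insert_of_notMem hv] at h3
  omega

/-- If all degrees are at least two, then two vertices burn per round on average. -/
theorem two_mul_burningGameLength_le
    (hdeg : ∀ v, ∃ a b, G.Adj v a ∧ G.Adj v b ∧ a ≠ b) (p : BurningPlayer) (B : Finset V) :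
    2 * burningGameLength G p B ≤ Bᶜ.card + 1 := by
  induction hk : Bᶜ.card using Nat.strong_induction_on generalizing p B with
  | _ k ih =>
    subst hk
    by_cases hB : B = Finset.univ
    · rw [hB, burningGameLength_univ]; omega
    have hpos : 0 < Bᶜ.card :=
      Finset.card_pos.mpr (Finset.nonempty_iff_ne_empty.mpr fun h0 =>
        hB ((Finset.compl_eq_empty_iff _).mp h0))
    by_cases hc : burningSpread G B = B
    -- `B` is closed under spreading, so this round burns only the selected `v`. The loss is made up
    -- in the next round: all neighbours of `v` are still unburned, and at least two of them catch
    -- fire.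
    · suffices h : burningGameLength G p B ≤ ((Bᶜ.card + 1) / 2 - 1) + 1 by omega
      refine burningGameLength_le_succ G p fun q v hv => ?_
      have e1 := card_compl_insert_burningSpread G hv
      rw [hc] at hv e1 ⊢
      obtain ⟨a, b, ha, hb, hab⟩ := hdeg v
      have hnew : ∀ x, G.Adj v x → x ∈ burningSpread G (insert v B) \ insert v B := by
        intro x hx
        rw [Finset.mem_sdiff, mem_burningSpread, Finset.mem_insert]
        refine ⟨Or.inr ⟨v, Finset.mem_insert_self _ _, hx⟩, ?_⟩
        rintro (rfl | hxB)
        · exact G.loopless.irrefl _ hx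
        · apply hv
          rw [← hc, mem_burningSpread]
          exact Or.inr ⟨x, hxB, hx.symm⟩
      have h2 : 2 ≤ (burningSpread G (insert v B) \ insert v B).card := by
        rw [← Finset.card_pair hab]
        refine Finset.card_le_card ?_
        intro x hx
        rw [Finset.mem_insert, Finset.mem_singleton] at hx
        rcases hx with rfl | rfl
        · exact hnew _ ha
        · exact hnew _ hb
      have h3 : 2 ≤ (insert v B)ᶜ.card :=
        h2.trans (Finset.card_le_card fun x hx =>
          Finset.mem_compl.mpr (Finset.mem_sdiff.mp hx).2)
      simp only [Finset.sdiff_self, Finset.card_empty] at e1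
      -- If the next spread ends the game, at least three vertices burn in at most two rounds; this
      -- is where the `+ 1` in the bound is needed. Otherwise two rounds burn at least 1 + 2 + 1 =
      -- 4.
      by_cases hu : burningSpread G (insert v B) = Finset.univ
      · have := burningGameLength_le_one_of_spread_eq_univ G q hu
        omega
      · suffices h : burningGameLength G q (insert v B) ≤ ((Bᶜ.card + 1) / 2 - 2) + 1 by omega
        refine burningGameLength_le_succ G q fun r w hw => ?_
        have e2 := card_compl_insert_burningSpread G hw
        have := ih _ (by omega) r (insert w (burningSpread G (insert v B))) rfl
        omega
    -- Here one round burns at least two vertices: one by spreading, one by selection.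
    · have h1 : 1 ≤ (burningSpread G B \ B).card := by
        rw [Nat.one_le_iff_ne_zero, Ne, Finset.card_eq_zero, Finset.sdiff_eq_empty_iff_subset]
        exact fun h => hc (h.antisymm (subset_burningSpread G B))
      suffices h : burningGameLength G p B ≤ ((Bᶜ.card + 1) / 2 - 1) + 1 by omega
      refine burningGameLength_le_succ G p fun q v hv => ?_
      have e1 := card_compl_insert_burningSpread G hv
      have := ih _ (by omega) q (insert v (burningSpread G B)) rfl
      omega

theorem two_mul_gameBurningNumber_le
    (hdeg : ∀ v, ∃ a b, G.Adj v a ∧ G.Adj v b ∧ a ≠ b) :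
    2 * gameBurningNumber G ≤ Fintype.card V + 1 := by
  simpa [gameBurningNumber] using two_mul_burningGameLength_le G hdeg .burner ∅

/-- A vertex with at most one non-neighbour lets Burner finish within two rounds. -/
theorem gameBurningNumber_le_two (v : V)
    (h : ∀ a b, a ≠ v → b ≠ v → ¬G.Adj v a → ¬G.Adj v b → a = b) :
    gameBurningNumber G ≤ 2 := by
  refine gameBurningNumber_le_succ G v ?_
  refine burningGameLength_le_succ G _ fun q w hw => ?_
  -- After the second spread at most one vertex is unburned, so the selection `w` is forced and
  -- finishes the game.
  have : insert w (burningSpread G {v}) = Finset.univ := by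
    ext x
    simp only [mem_burningSpread, Finset.mem_singleton, exists_eq_left, not_or] at hw
    simp only [Finset.mem_insert, mem_burningSpread, Finset.mem_singleton, exists_eq_left,
      Finset.mem_univ, iff_true]
    by_contra! hx
    exact hx.1 (h x w hx.2.1 hw.1 hx.2.2 hw.2)
  rw [this, burningGameLength_univ]

/-- A vertex of eccentricity at most two lets Burner finish within three rounds. -/
theorem gameBurningNumber_le_three (v : V)
    (h : ∀ x, x = v ∨ G.Adj v x ∨ ∃ y, G.Adj v y ∧ G.Adj y x) :
    gameBurningNumber G ≤ 3 := by
  refine gameBurningNumber_le_succ G v ?_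
  refine burningGameLength_le_succ G _ fun q w _ => ?_
  -- Whatever `w` is, the third spread covers the ball of radius 2 around `v`.
  refine burningGameLength_le_one_of_spread_eq_univ G q ?_
  ext x
  simp only [Finset.mem_univ, iff_true, mem_burningSpread, Finset.mem_insert,
    Finset.mem_singleton, exists_eq_left]
  rcases h x with hx | hx | ⟨y, hy, hyx⟩
  · exact Or.inl (Or.inr (Or.inl hx))
  · exact Or.inl (Or.inr (Or.inr hx))
  · exact Or.inr ⟨y, Or.inr (Or.inr hy), hyx⟩

/-- The neighbours of `v` in `G` are its non-neighbours in `Gᶜ`. -/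
theorem gameBurningNumber_compl_le_two (v : V)
    (h : ∀ a b, G.Adj v a → G.Adj v b → a = b) : gameBurningNumber Gᶜ ≤ 2 := by
  refine gameBurningNumber_le_two Gᶜ v fun a b ha hb hva hvb => ?_
  simp only [SimpleGraph.compl_adj, not_and, not_not] at hva hvb
  exact h a b (hva ha.symm) (hvb hb.symm)

/-- A graph or its complement has a vertex of eccentricity at most two. -/
theorem gameBurningNumber_le_three_or_compl [Nonempty V] :
    gameBurningNumber G ≤ 3 ∨ gameBurningNumber Gᶜ ≤ 3 := by
  obtain ⟨v⟩ := ‹Nonempty V›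
  by_cases h : ∀ x, x = v ∨ G.Adj v x ∨ ∃ y, G.Adj v y ∧ G.Adj y x
  · exact Or.inl (gameBurningNumber_le_three G v h)
  · right
    push Not at h
    obtain ⟨x, hxv, hvx, hx⟩ := h
    -- Since `x` is at distance more than 2 from `v`, no neighbour `z` of `v` is adjacent to `x`, so
    -- `v`, `x`, `z` is a path in `Gᶜ`.
    refine gameBurningNumber_le_three Gᶜ v fun z => ?_
    by_cases hz : z = v
    · exact Or.inl hz
    by_cases hvz : G.Adj v z
    · refine Or.inr (Or.inr ⟨x, ?_, ?_⟩)
      · exact (SimpleGraph.compl_adj _ _ _).mpr ⟨hxv.symm, hvx⟩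
      · refine (SimpleGraph.compl_adj _ _ _).mpr ⟨?_, fun hxz => hx z hvz hxz.symm⟩
        rintro rfl
        exact hvx hvz
    · exact Or.inr (Or.inl ((SimpleGraph.compl_adj _ _ _).mpr ⟨Ne.symm hz, hvz⟩))

end BurningGame

theorem mainTheorem9 {V : Type*} [Fintype V] [DecidableEq V] (G : SimpleGraph V)
    [DecidableRel G.Adj] (hn : 2 ≤ Fintype.card V) :
    4 ≤ gameBurningNumber G * gameBurningNumber Gᶜ ∧
      gameBurningNumber G * gameBurningNumber Gᶜ ≤ 2 * Fintype.card V := by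
  refine ⟨Nat.mul_le_mul (two_le_gameBurningNumber G hn) (two_le_gameBurningNumber Gᶜ hn), ?_⟩
  have : Nonempty V := Fintype.card_pos_iff.mp (by omega)
  have hG := gameBurningNumber_le_card G
  have hGc := gameBurningNumber_le_card Gᶜ
  by_cases h1 : ∀ v, ∃ a b, G.Adj v a ∧ G.Adj v b ∧ a ≠ b
  · by_cases h2 : ∀ v, ∃ a b, Gᶜ.Adj v a ∧ Gᶜ.Adj v b ∧ a ≠ b
    · have b1 := two_mul_gameBurningNumber_le G h1
      have b2 := two_mul_gameBurningNumber_le Gᶜ h2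
      -- Needed for 3(n + 1) ≤ 4n; a vertex and two of its neighbours provide it.
      have h3 : 3 ≤ Fintype.card V := by
        obtain ⟨v⟩ := this
        obtain ⟨a, b, ha, hb, hab⟩ := h1 v
        rw [← Finset.card_eq_three.mpr ⟨v, a, b, ha.ne, hb.ne, hab, rfl⟩]
        exact Finset.card_le_univ _
      rcases gameBurningNumber_le_three_or_compl G with h | h
      · have := Nat.mul_le_mul_right (gameBurningNumber Gᶜ) h
        omega
      · have := Nat.mul_le_mul_left (gameBurningNumber G) h
        omega
    · push Not at h2
      obtain ⟨v, hv⟩ := h2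
      have h : gameBurningNumber G ≤ 2 := by
        refine gameBurningNumber_le_two G v fun a b ha hb hva hvb => ?_
        exact hv a b ((SimpleGraph.compl_adj _ _ _).mpr ⟨ha.symm, hva⟩)
          ((SimpleGraph.compl_adj _ _ _).mpr ⟨hb.symm, hvb⟩)
      exact Nat.mul_le_mul h hGc
  · push Not at h1
    obtain ⟨v, hv⟩ := h1
    have h := gameBurningNumber_compl_le_two G v hv
    rw [Nat.mul_comm 2]
    exact Nat.mul_le_mul hG h
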